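/- All graphs are finite and simple. The connectivity $\kappa(G)$ of a connected non-complete graph $G$ is the smallest size of a set $S\subseteq V(G)$ for which $G-S$ is disconnected. The deck of a graph $G$ is the multiset of the graphs $G-v$, $v\in V(G)$, each taken up to isomorphism, and $G$ is called reconstructible if every graph $H$ with the same deck as $G$ is isomorphic to $G$. Theorem. If $G$ is a triangle-free graph with $\mathrm{diam}(G)=2$ and $\kappa(G)=3$, then $G$ is reconstructible. -/

import Mathlib

universe u

namespace GraphRecon

/-- Isomorphism of graphs on vertex types in `Type u`, as an equivalence relation. -/
def isoSetoid : Setoid (Σ V : Type u, SimpleGraph V) where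
  r A B := Nonempty (A.2 ≃g B.2)
  iseqv :=
    ⟨fun _ => ⟨SimpleGraph.Iso.refl⟩, fun ⟨e⟩ => ⟨e.symm⟩, fun ⟨e⟩ ⟨f⟩ => ⟨e.trans f⟩⟩

/-- Isomorphism classes of graphs, i.e. unlabelled graphs. -/
def IsoClass : Type (u + 1) := Quotient isoSetoid.{u}

/-- The isomorphism class of a graph. -/
def isoClass {V : Type u} (G : SimpleGraph V) : IsoClass.{u} :=
  Quotient.mk isoSetoid ⟨V, G⟩

theorem isoClass_eq_iff {V W : Type u} {G : SimpleGraph V} {H : SimpleGraph W} :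
    isoClass G = isoClass H ↔ Nonempty (G ≃g H) :=
  Quotient.eq (r := isoSetoid.{u})

/-- The card `G - v`. -/
abbrev card {V : Type u} (G : SimpleGraph V) (v : V) : SimpleGraph ({v}ᶜ : Set V) :=
  G.induce {v}ᶜ

/-- The deck of `G`: the multiset of its cards `G - v`, each taken up to isomorphism. -/
def deck {V : Type u} [Fintype V] (G : SimpleGraph V) : Multiset IsoClass.{u} :=
  (Finset.univ : Finset V).val.map fun v => isoClass (card G v)

/-- `G` is reconstructible: every finite graph with the same deck is isomorphic to `G`. -/
def Reconstructible {V : Type u} [Fintype V] (G : SimpleGraph V) : Prop :=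
  ∀ (W : Type u) [Fintype W] (H : SimpleGraph W), deck H = deck G → Nonempty (G ≃g H)

/-- `S` is a cut set of `G`: the graph `G - S` is disconnected
(it has two vertices not joined by a walk). -/
def IsCutSet {V : Type u} (G : SimpleGraph V) (S : Set V) : Prop :=
  ¬ (G.induce Sᶜ).Preconnected

/-- The connectivity `κ(G)`: the least size of a vertex set whose removal leaves a
disconnected graph or at most one vertex. The second alternative is the usual convention that
gives complete graphs on `n ≥ 1` vertices the connectivity `n - 1`. If two vertices are
nonadjacent, the minimum is attained only by cut sets. -/
noncomputable def connectivity {V : Type u} [Fintype V] (G : SimpleGraph V) : ℕ :=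
  sInf {k : ℕ | ∃ S : Finset V, S.card = k ∧
    (IsCutSet G (S : Set V) ∨ Fintype.card V ≤ k + 1)}

end GraphRecon

/-!
A triangle-free graph of diameter two and connectivity three has minimum degree exactly three. It
is at least the connectivity (`connectivity_le_degree`), and a vertex of degree at most three is
found beside a cut set of size three: two adjacent vertices on each of the two sides would need four
different common neighbours in the cut set (`exists_degree_le_three`).

Let `v` have the neighbours `x`, `y`, `z`. The card `G - x` determines `G` if `x` is chosen suitably
among the three. Let `H` be another graph with `H - x = G - x` that is
triangle-free, of diameter two and of minimum degree three. Then `v` has degree two in the card, so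
`x` is adjacent to `v` in `H`, and every vertex `u` adjacent to `x` in `G` turns out to be adjacent
to `x` in `H` as well. If `u` is adjacent to both `y` and `z`, its degree is three in `G` and two in
the card; if to neither, then `x` is its only possible common neighbour with `v` in `H`; if to `y`
only and there is a vertex `t` adjacent to `x` and `z` but not to `y`, then `u` and `t` have no
common neighbour in the card (`adj_of_adj_of_two_classes`). So the argument needs that the classes
`{x, y}` and `{x, z}` are both empty or both nonempty, which by the pigeonhole principle holds after
a permutation of `x`, `y`, `z` (`exists_balanced_neighbor`). Conversely, the neighbourhood of `x` in
`G` is a maximal independent set of the card, so it cannot be enlarged (`eq_of_agree`).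

It remains to see that a graph `H` with the deck of `G` has the properties used. Degrees and
triangles are read off the cards as usual. For the diameter, the number of pairs without a common
neighbour is a weighted sum, over all cards, of the pairs with their codegrees
(`sum_codegreeSum_card`, `exists_codegree_weight`, `hasCommonNeighbors_of_cards`).
-/

namespace GraphRecon

/-- Any two distinct nonadjacent vertices have a common neighbour (for non-complete graphs: the
diameter is two). -/
def HasCommonNeighbors {V : Type u} (G : SimpleGraph V) : Prop :=
  ∀ a b, a ≠ b → ¬ G.Adj a b → ∃ c, G.Adj c a ∧ G.Adj c b

/-- Minimum degree at least three, phrased without cardinalities: every vertex has a neighbour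
avoiding any two prescribed vertices. -/
def MinDegreeThree {V : Type u} (G : SimpleGraph V) : Prop :=
  ∀ v p q, ∃ r, G.Adj v r ∧ r ≠ p ∧ r ≠ q

theorem not_adj_of_cliqueFree_three {V : Type u} {G : SimpleGraph V} (hG : G.CliqueFree 3)
    {a b c : V} (hab : G.Adj a b) (hbc : G.Adj b c) : ¬ G.Adj a c := fun hac => by
  classical
  exact hG {a, b, c} (SimpleGraph.is3Clique_triple_iff.2 ⟨hab, hac, hbc⟩)

theorem MinDegreeThree.of_three_le_degree {V : Type u} [Fintype V] {G : SimpleGraph V}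
    [DecidableRel G.Adj] (h : ∀ v, 3 ≤ G.degree v) : MinDegreeThree G := fun v p q => by
  classical
  obtain ⟨r, hr, hr'⟩ := Finset.exists_mem_notMem_of_card_lt_card
    (s := {p, q}) (t := G.neighborFinset v)
    (lt_of_le_of_lt Finset.card_le_two (by
      rw [SimpleGraph.card_neighborFinset_eq_degree]
      exact h v))
  exact ⟨r, by simpa using hr, by simp_all, by simp_all⟩

/-! ### Recovering the neighbourhood of a deleted vertex -/

section DeletedNeighborhood

variable {V : Type u} {G H : SimpleGraph V} {x y z v : V}

/-- A vertex of degree three in `G` keeps its neighbourhood in every graph `H` of minimum degree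
three that agrees with `G` away from one of its neighbours. -/
theorem adj_iff_of_agree (hag : ∀ a b, a ≠ x → b ≠ x → (G.Adj a b ↔ H.Adj a b))
    (mH : MinDegreeThree H) (hv : ∀ w, G.Adj v w ↔ w = x ∨ w = y ∨ w = z) (w : V) :
    H.Adj v w ↔ w = x ∨ w = y ∨ w = z := by
  have hvx : v ≠ x := ((hv x).2 (Or.inl rfl)).ne
  by_cases hw : w = x
  · subst hw
    obtain ⟨r, hr, hry, hrz⟩ := mH v y z
    have : r = w := by
      by_contra h
      have := (hv r).1 ((hag v r hvx h).2 hr)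
      tauto
    subst this
    tauto
  · rw [← hag v w hvx hw, hv]

/-- The case of a vertex `u` adjacent to `x` and `y` only. A vertex `t` adjacent to `x` and `z`
only is nonadjacent to `u`; without the edge `xu` the two would have no common neighbour in `H`,
since a common neighbour other than `x` would have no common neighbour with `v`. -/
theorem adj_of_adj_of_two_classes (hag : ∀ a b, a ≠ x → b ≠ x → (G.Adj a b ↔ H.Adj a b))
    (tG : G.CliqueFree 3) (dG : HasCommonNeighbors G) (dH : HasCommonNeighbors H)
    (hv : ∀ w, G.Adj v w ↔ w = x ∨ w = y ∨ w = z) {u t : V}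
    (hxu : G.Adj x u) (hyu : G.Adj y u) (hzu : ¬ G.Adj z u)
    (hxt : G.Adj x t) (hyt : ¬ G.Adj y t) (hzt : G.Adj z t) : H.Adj x u := by
  have tri {a b c : V} (h₁ : G.Adj a b) (h₂ : G.Adj b c) : ¬ G.Adj a c :=
    not_adj_of_cliqueFree_three tG h₁ h₂
  have hut : u ≠ t := by rintro rfl; exact hyt hyu
  have hnut : ¬ G.Adj u t := fun h => tri hxu h hxt
  by_contra hcon
  obtain ⟨w, hwu, hwt⟩ := dH u t hut fun h => hnut ((hag u t hxu.ne' hxt.ne').2 h)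
  have hwx : w ≠ x := by rintro rfl; exact hcon hwu
  rw [← hag w u hwx hxu.ne'] at hwu
  rw [← hag w t hwx hxt.ne'] at hwt
  have hnx : ¬ G.Adj x w := fun h => tri h hwu hxu
  have hny : ¬ G.Adj y w := fun h => tri h hwu hyu
  have hnz : ¬ G.Adj z w := fun h => tri h hwt hzt
  have hwv : w ≠ v := by
    rintro rfl
    exact hnx ((hv x).2 (Or.inl rfl)).symm
  have hnwv : ¬ G.Adj w v := fun h => by
    rcases (hv w).1 h.symm with rfl | rfl | rfl
    · exact hwx rfl
    · exact hyt hwt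
    · exact hzu hwu
  obtain ⟨c, hcw, hcv⟩ := dG w v hwv hnwv
  rcases (hv c).1 hcv.symm with rfl | rfl | rfl
  exacts [hnx hcw, hny hcw, hnz hcw]

theorem adj_of_adj_of_agree (hag : ∀ a b, a ≠ x → b ≠ x → (G.Adj a b ↔ H.Adj a b))
    (tG : G.CliqueFree 3) (dG : HasCommonNeighbors G)
    (dH : HasCommonNeighbors H) (mH : MinDegreeThree H)
    (hv : ∀ w, G.Adj v w ↔ w = x ∨ w = y ∨ w = z)
    (hP : (∃ t, G.Adj x t ∧ G.Adj y t ∧ ¬ G.Adj z t) ↔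
      ∃ t, G.Adj x t ∧ ¬ G.Adj y t ∧ G.Adj z t) {u : V} (hu : G.Adj x u) : H.Adj x u := by
  have tri {a b c : V} (h₁ : G.Adj a b) (h₂ : G.Adj b c) : ¬ G.Adj a c :=
    not_adj_of_cliqueFree_three tG h₁ h₂
  have hvH := adj_iff_of_agree hag mH hv
  have hvx : G.Adj v x := (hv x).2 (Or.inl rfl)
  have hvu : ¬ G.Adj v u := fun h => tri hvx hu h
  by_cases hy : G.Adj y u <;> by_cases hz : G.Adj z u
  · -- All neighbours of `u` lie in `{x, y, z}`: any other vertex has a neighbour there.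
    obtain ⟨r, hr, hry, hrz⟩ := mH u y z
    by_cases hrx : r = x
    · subst hrx; exact hr.symm
    · rw [← hag u r hu.ne' hrx] at hr
      have hrv : r ≠ v := by rintro rfl; exact hvu hr.symm
      obtain ⟨c, hcr, hcv⟩ := dG r v hrv fun h => by
        have := (hv r).1 h.symm
        tauto
      rcases (hv c).1 hcv.symm with rfl | rfl | rfl
      exacts [(tri hu hr hcr).elim, (tri hy hr hcr).elim, (tri hz hr hcr).elim]
  · obtain ⟨t, ht, hyt, hzt⟩ := hP.1 ⟨u, hu, hy, hz⟩
    exact adj_of_adj_of_two_classes hag tG dG dH hv hu hy hz ht hyt hzt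
  · obtain ⟨t, ht, hyt, hzt⟩ := hP.2 ⟨u, hu, hy, hz⟩
    exact adj_of_adj_of_two_classes (y := z) (z := y) hag tG dG dH
      (fun w => (hv w).trans (by tauto)) hu hz hy ht hzt hyt
  · by_cases huv : u = v
    · subst huv; exact ((hvH x).2 (Or.inl rfl)).symm
    · have hyx : y ≠ x := by rintro rfl; exact hy hu
      have hzx : z ≠ x := by rintro rfl; exact hz hu
      obtain ⟨c, hcu, hcv⟩ := dH u v huv fun h =>
        hvu ((hag v u hvx.ne hu.ne').2 h.symm)
      rcases (hvH c).1 hcv.symm with rfl | rfl | rfl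
      · exact hcu
      · exact (hy ((hag _ u hyx hu.ne').2 hcu)).elim
      · exact (hz ((hag _ u hzx hu.ne').2 hcu)).elim

/-- The card `G - x` determines the neighbourhood of `x` when `x` is a neighbour of a vertex `v`
of degree three and the two classes of vertices sharing exactly one further neighbour of `v` with
`x` are both empty or both nonempty. -/
theorem eq_of_agree (hag : ∀ a b, a ≠ x → b ≠ x → (G.Adj a b ↔ H.Adj a b))
    (tG : G.CliqueFree 3) (tH : H.CliqueFree 3) (dG : HasCommonNeighbors G)
    (dH : HasCommonNeighbors H) (mH : MinDegreeThree H)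
    (hv : ∀ w, G.Adj v w ↔ w = x ∨ w = y ∨ w = z)
    (hP : (∃ t, G.Adj x t ∧ G.Adj y t ∧ ¬ G.Adj z t) ↔
      ∃ t, G.Adj x t ∧ ¬ G.Adj y t ∧ G.Adj z t) : G = H := by
  have hGH {u : V} (hu : G.Adj x u) : H.Adj x u := adj_of_adj_of_agree hag tG dG dH mH hv hP hu
  -- `N_G(x)` is a maximal independent set of `G - x`, and `N_H(x)` is independent.
  have hx (u : V) : G.Adj x u ↔ H.Adj x u := by
    refine ⟨hGH, fun hu => ?_⟩
    by_contra h
    obtain ⟨c, hcx, hcu⟩ := dG x u hu.ne h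
    exact not_adj_of_cliqueFree_three tH (hGH hcx.symm) ((hag c u hcx.ne hu.ne').1 hcu) hu
  ext a b
  by_cases ha : a = x
  · subst ha; exact hx b
  · by_cases hb : b = x
    · subst hb; rw [G.adj_comm, H.adj_comm]; exact hx a
    · exact hag a b ha hb

end DeletedNeighborhood

/-! ### Vertices of degree three -/

theorem hasCommonNeighbors_of_diam_eq_two {V : Type u} {G : SimpleGraph V} (h : G.diam = 2) :
    HasCommonNeighbors G := by
  intro a b hab hadj
  by_contra hc
  have htop : G.ediam ≠ ⊤ := G.ediam_ne_top_of_diam_ne_zero (by omega)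
  have h2 : G.edist a b ≤ 2 := by
    refine G.edist_le_ediam.trans ?_
    rw [← ENat.natCast_toNat htop]
    exact_mod_cast h.le
  refine absurd h2 (not_le.2 (G.two_lt_edist_iff.2 ⟨hab, hadj, ?_⟩))
  rw [Set.eq_empty_iff_forall_notMem]
  rintro c ⟨h₁, h₂⟩
  exact hc ⟨c, h₁.symm, h₂.symm⟩

section Structure

variable {V : Type u} [Fintype V] {G : SimpleGraph V}

theorem connectivity_le_degree [DecidableRel G.Adj] (v : V) : connectivity G ≤ G.degree v := by
  classical
  refine Nat.sInf_le ⟨G.neighborFinset v, G.card_neighborFinset_eq_degree v, ?_⟩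
  by_cases hn : Fintype.card V ≤ G.degree v + 1
  · exact Or.inr hn
  · left
    obtain ⟨w, -, hw⟩ := Finset.exists_mem_notMem_of_card_lt_card
      (s := insert v (G.neighborFinset v)) (t := Finset.univ) (by
        rw [Finset.card_univ]
        exact (Finset.card_insert_le _ _).trans_lt (by simpa using hn))
    simp only [Finset.mem_insert, SimpleGraph.mem_neighborFinset, not_or] at hw
    intro hpre
    obtain ⟨p⟩ := hpre ⟨v, by simp⟩ ⟨w, by simpa using hw.2⟩
    cases p with
    | nil => exact hw.1 rfl
    | @cons _ c _ hadj p => exact c.2 (by simpa using hadj)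

/-- Let `S` be a cut set of size three and `a`, `b` vertices in different parts of `G - S`. If
both had a neighbour outside `S`, say `a'` and `b'`, then the four pairs formed by one of `a, a'`
and one of `b, b'` would have common neighbours in `S`, and these are distinct as `G` is
triangle-free. So one of `a`, `b` has all its neighbours in `S`. -/
theorem exists_degree_le_three [DecidableRel G.Adj] (tG : G.CliqueFree 3)
    (dG : HasCommonNeighbors G) {S : Finset V} (hS : S.card = 3) (hcut : IsCutSet G (S : Set V)) :
    ∃ v, G.degree v ≤ 3 := by
  classical
  by_contra! hdeg
  have tri {a b c : V} (h₁ : G.Adj a b) (h₂ : G.Adj b c) : ¬ G.Adj a c :=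
    not_adj_of_cliqueFree_three tG h₁ h₂
  have hout (v : V) : ∃ w, G.Adj v w ∧ w ∉ S := by
    obtain ⟨w, hw, hw'⟩ := Finset.exists_mem_notMem_of_card_lt_card
      (s := S) (t := G.neighborFinset v) (by simpa [hS] using hdeg v)
    exact ⟨w, by simpa using hw, hw'⟩
  unfold IsCutSet SimpleGraph.Preconnected at hcut
  push Not at hcut
  obtain ⟨a, b, hab⟩ := hcut
  obtain ⟨a', haa', ha'⟩ := hout a
  obtain ⟨b', hbb', hb'⟩ := hout b
  set K := G.induce ((S : Set V)ᶜ)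
  have common (p q : ((S : Set V)ᶜ : Set V)) (hpq : ¬ K.Reachable p q) :
      ∃ s ∈ S, G.Adj s p ∧ G.Adj s q := by
    obtain ⟨c, hcp, hcq⟩ := dG p q (fun h => hpq (by rw [Subtype.ext h]))
      fun h => hpq (SimpleGraph.Adj.reachable (G := K) h)
    refine ⟨c, ?_, hcp, hcq⟩
    by_contra hc
    have h₁ : K.Adj p ⟨c, by simpa using hc⟩ := hcp.symm
    have h₂ : K.Adj ⟨c, by simpa using hc⟩ q := hcq
    exact hpq (h₁.reachable.trans h₂.reachable)
  have hA : K.Adj a ⟨a', by simpa using ha'⟩ := haa'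
  have hB : K.Adj b ⟨b', by simpa using hb'⟩ := hbb'
  obtain ⟨s₁, m₁, p₁, q₁⟩ := common a b hab
  obtain ⟨s₂, m₂, p₂, q₂⟩ := common a ⟨b', by simpa using hb'⟩
    fun h => hab (h.trans hB.reachable.symm)
  obtain ⟨s₃, m₃, p₃, q₃⟩ := common ⟨a', by simpa using ha'⟩ b
    fun h => hab (hA.reachable.trans h)
  obtain ⟨s₄, m₄, p₄, q₄⟩ := common ⟨a', by simpa using ha'⟩ ⟨b', by simpa using hb'⟩
    fun h => hab ((hA.reachable.trans h).trans hB.reachable.symm)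
  have n₁₂ : s₁ ≠ s₂ := by rintro rfl; exact tri q₁ hbb' q₂
  have n₁₃ : s₁ ≠ s₃ := by rintro rfl; exact tri p₁ haa' p₃
  have n₁₄ : s₁ ≠ s₄ := by rintro rfl; exact tri p₁ haa' p₄
  have n₂₃ : s₂ ≠ s₃ := by rintro rfl; exact tri p₂ haa' p₃
  have n₂₄ : s₂ ≠ s₄ := by rintro rfl; exact tri p₂ haa' p₄
  have n₃₄ : s₃ ≠ s₄ := by rintro rfl; exact tri q₃ hbb' q₄
  have hsub : ({s₁, s₂, s₃, s₄} : Finset V) ⊆ S := by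
    simp [Finset.insert_subset_iff, m₁, m₂, m₃, m₄]
  have := Finset.card_le_card hsub
  rw [Finset.card_eq_of_equiv_fin (n := 4) (Finset.equivFinOfCardEq (by
    simp [n₁₂, n₁₃, n₁₄, n₂₃, n₂₄, n₃₄]))] at this
  omega

theorem four_lt_card [DecidableRel G.Adj] (tG : G.CliqueFree 3) (hdeg : ∀ v, 3 ≤ G.degree v)
    (v : V) : 4 < Fintype.card V := by
  classical
  have hpos : 0 < G.degree v := by have := hdeg v; omega
  obtain ⟨w, hw⟩ := (G.degree_pos_iff_exists_adj v).1 hpos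
  have hdis : Disjoint (G.neighborFinset v) (G.neighborFinset w) := by
    rw [Finset.disjoint_left]
    intro c hc hc'
    rw [SimpleGraph.mem_neighborFinset] at hc hc'
    exact not_adj_of_cliqueFree_three tG hw hc' hc
  have h := Finset.card_le_univ (G.neighborFinset v ∪ G.neighborFinset w)
  rw [Finset.card_union_of_disjoint hdis] at h
  have h₁ := hdeg v
  have h₂ := hdeg w
  simp only [SimpleGraph.card_neighborFinset_eq_degree] at h
  omega

theorem exists_degree_eq_three [DecidableRel G.Adj] (tG : G.CliqueFree 3)
    (dG : HasCommonNeighbors G) (hκ : connectivity G = 3) : ∃ v, G.degree v = 3 := by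
  have hdeg (v : V) : 3 ≤ G.degree v := hκ ▸ connectivity_le_degree v
  have hne : {k : ℕ | ∃ S : Finset V, S.card = k ∧
      (IsCutSet G (S : Set V) ∨ Fintype.card V ≤ k + 1)}.Nonempty :=
    Nat.nonempty_of_pos_sInf (by unfold connectivity at hκ; omega)
  obtain ⟨S, hS, hcut⟩ := Nat.sInf_mem hne
  change S.card = connectivity G at hS
  change _ ∨ _ ≤ connectivity G + 1 at hcut
  rw [hκ] at hS hcut
  obtain ⟨s, -⟩ : S.Nonempty := Finset.card_pos.1 (by omega)
  have := four_lt_card tG hdeg s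
  obtain ⟨v, hv⟩ := exists_degree_le_three tG dG hS (hcut.resolve_right (by omega))
  exact ⟨v, le_antisymm hv (hdeg v)⟩

/-- Among the three neighbours of a vertex `v` of degree three, two of the three classes of
vertices adjacent to exactly two of them are both empty or both nonempty; `x` is the neighbour of
`v` common to those two classes. -/
theorem exists_balanced_neighbor [DecidableRel G.Adj] {v : V} (hv : G.degree v = 3) :
    ∃ x y z, (∀ w, G.Adj v w ↔ w = x ∨ w = y ∨ w = z) ∧
      ((∃ t, G.Adj x t ∧ G.Adj y t ∧ ¬ G.Adj z t) ↔
        ∃ t, G.Adj x t ∧ ¬ G.Adj y t ∧ G.Adj z t) := by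
  classical
  rw [← SimpleGraph.card_neighborFinset_eq_degree, Finset.card_eq_three] at hv
  obtain ⟨x, y, z, -, -, -, h⟩ := hv
  have hv (w : V) : G.Adj v w ↔ w = x ∨ w = y ∨ w = z := by
    rw [← SimpleGraph.mem_neighborFinset, h]; simp
  by_cases h₁ : (∃ t, G.Adj x t ∧ G.Adj y t ∧ ¬ G.Adj z t) ↔
      ∃ t, G.Adj x t ∧ ¬ G.Adj y t ∧ G.Adj z t
  · exact ⟨x, y, z, hv, h₁⟩
  by_cases h₂ : (∃ t, G.Adj x t ∧ G.Adj y t ∧ ¬ G.Adj z t) ↔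
      ∃ t, ¬ G.Adj x t ∧ G.Adj y t ∧ G.Adj z t
  · refine ⟨y, x, z, fun w => (hv w).trans (by tauto), ?_⟩
    exact ((exists_congr fun t => by tauto).trans h₂).trans (exists_congr fun t => by tauto)
  · refine ⟨z, x, y, fun w => (hv w).trans (by tauto), ?_⟩
    have h₃ : (∃ t, G.Adj x t ∧ ¬ G.Adj y t ∧ G.Adj z t) ↔
      ∃ t, ¬ G.Adj x t ∧ G.Adj y t ∧ G.Adj z t :=
      (not_iff.1 h₁).symm.trans (not_iff.1 h₂)
    exact ((exists_congr fun t => by tauto).trans h₃).trans (exists_congr fun t => by tauto)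

end Structure

/-! ### Degrees and triangles from the cards -/

section Kelly

variable {V W : Type u} [Fintype V] [Fintype W] {G : SimpleGraph V} {H : SimpleGraph W}

theorem exists_equiv_of_deck_eq (h : deck H = deck G) :
    ∃ σ : V ≃ W, ∀ v, Nonempty (card G v ≃g card H (σ v)) := by
  classical
  have key (c : IsoClass) : Nonempty ({v : V // isoClass (card G v) = c} ≃
      {w : W // isoClass (card H w) = c}) := by
    rw [← Fintype.card_eq, Fintype.card_subtype, Fintype.card_subtype]
    have := congrArg (Multiset.count c) h
    rw [deck, deck, Multiset.count_map, Multiset.count_map] at this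
    simpa only [Finset.card_def, Finset.filter_val, eq_comm] using this.symm
  let e := fun c => (key c).some
  refine ⟨Equiv.ofFiberEquiv e, fun v => isoClass_eq_iff.1 ?_⟩
  exact (Equiv.ofFiberEquiv_map e v).symm

theorem sum_compl_singleton {M : Type*} [AddCommMonoid M] [DecidableEq V] (v : V) (f : V → M) :
    ∑ a : ({v}ᶜ : Set V), f a = ∑ a, if a = v then 0 else f a := by
  rw [← Finset.sum_subtype (Finset.univ.filter (· ≠ v)) (p := (· ∈ ({v}ᶜ : Set V))) (by simp),
    Finset.sum_filter]
  exact Finset.sum_congr rfl fun a _ => by by_cases h : a = v <;> simp [h]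

theorem card_edgeFinset_card_add_degree [DecidableEq V] [DecidableRel G.Adj] (v : V) :
    (card G v).edgeFinset.card + G.degree v = G.edgeFinset.card := by
  have h₁ := (G.card_edgeFinset_induce_compl_singleton v).trans
    (G.card_edgeFinset_deleteIncidenceSet v)
  have h₂ := G.degree_le_card_edgeFinset v
  unfold card
  omega

/-- Every edge lies in all cards but two. -/
theorem sum_edges_card [DecidableEq V] [DecidableRel G.Adj] :
    ∑ v, (((card G v).edgeFinset.card : ℕ) : ℤ) = (Fintype.card V - 2) * G.edgeFinset.card := by
  have h (v : V) : (((card G v).edgeFinset.card : ℕ) : ℤ) = G.edgeFinset.card - G.degree v := by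
    rw [← card_edgeFinset_card_add_degree (G := G) v]; push_cast; ring
  simp only [h, Finset.sum_sub_distrib, ← Nat.cast_sum, G.sum_degrees_eq_twice_card_edges]
  simp; ring

theorem edges_eq_of_cards [DecidableEq V] [DecidableEq W] [DecidableRel G.Adj] [DecidableRel H.Adj]
    (σ : V ≃ W) (hσ : ∀ v, Nonempty (card G v ≃g card H (σ v))) (hV : 2 < Fintype.card V) :
    G.edgeFinset.card = H.edgeFinset.card := by
  have h : ∑ v, (((card G v).edgeFinset.card : ℕ) : ℤ) =
      ∑ w, (((card H w).edgeFinset.card : ℕ) : ℤ) := by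
    rw [← Equiv.sum_comp σ]
    exact Finset.sum_congr rfl fun v _ => by rw [(hσ v).some.card_edgeFinset_eq]
  rw [sum_edges_card, sum_edges_card, ← Fintype.card_congr σ] at h
  have h0 : ((Fintype.card V : ℤ) - 2) ≠ 0 := by omega
  exact_mod_cast mul_left_cancel₀ h0 h

theorem degree_eq_of_cards [DecidableEq V] [DecidableEq W] [DecidableRel G.Adj]
    [DecidableRel H.Adj] (σ : V ≃ W) (hσ : ∀ v, Nonempty (card G v ≃g card H (σ v)))
    (hV : 2 < Fintype.card V) (v : V) : G.degree v = H.degree (σ v) := by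
  have h₁ := card_edgeFinset_card_add_degree (G := G) v
  have h₂ := card_edgeFinset_card_add_degree (G := H) (σ v)
  have h₃ := (hσ v).some.card_edgeFinset_eq
  have h₄ := edges_eq_of_cards σ hσ hV
  omega

theorem cliqueFree_three_of_cards (σ : V ≃ W) (hσ : ∀ v, Nonempty (card G v ≃g card H (σ v)))
    (hV : 3 < Fintype.card V) (tG : G.CliqueFree 3) : H.CliqueFree 3 := by
  classical
  intro s hs
  obtain ⟨w, -, hw⟩ := Finset.exists_mem_notMem_of_card_lt_card (s := s) (t := Finset.univ)
    (by rw [hs.card_eq, Finset.card_univ, ← Fintype.card_congr σ]; exact hV)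
  obtain ⟨a, b, c, hab, hac, hbc, rfl⟩ := SimpleGraph.is3Clique_iff.1 hs
  obtain ⟨v, rfl⟩ := σ.surjective w
  obtain ⟨e⟩ := hσ v
  simp only [Finset.mem_insert, Finset.mem_singleton, not_or] at hw
  let A : ({σ v}ᶜ : Set W) := ⟨a, Ne.symm hw.1⟩
  let B : ({σ v}ᶜ : Set W) := ⟨b, Ne.symm hw.2.1⟩
  let C : ({σ v}ᶜ : Set W) := ⟨c, Ne.symm hw.2.2⟩
  have h₁ : (card G v).Adj (e.symm A) (e.symm B) := e.symm.map_rel_iff.2 hab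
  have h₂ : (card G v).Adj (e.symm B) (e.symm C) := e.symm.map_rel_iff.2 hbc
  have h₃ : (card G v).Adj (e.symm A) (e.symm C) := e.symm.map_rel_iff.2 hac
  exact not_adj_of_cliqueFree_three tG h₁ h₂ h₃

end Kelly

/-! ### Codegrees and diameter two from the cards -/

section Codegree

theorem ncard_commonNeighbors_card {V : Type u} (G : SimpleGraph V) (v : V) (a b : ({v}ᶜ : Set V)) :
    ((card G v).commonNeighbors a b).ncard = (G.commonNeighbors a b \ {v}).ncard := by
  rw [← Set.ncard_image_of_injective _ Subtype.val_injective]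
  congr 1
  ext c
  simp only [Set.mem_image, SimpleGraph.mem_commonNeighbors, Set.mem_sdiff, Set.mem_singleton_iff]
  constructor
  · rintro ⟨c, h, rfl⟩
    exact ⟨h, c.2⟩
  · rintro ⟨h, hc⟩
    exact ⟨⟨c, hc⟩, h, rfl⟩

variable {V W : Type u} [Fintype V] [Fintype W]

/-- The sum of `φ` of the codegree (the number of common neighbours) over all ordered pairs of
distinct vertices. -/
noncomputable def codegreeSum [DecidableEq V] (φ : ℕ → ℚ) (G : SimpleGraph V) : ℚ :=
  ∑ a, ∑ b, if a = b then 0 else φ (G.commonNeighbors a b).ncard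

theorem codegreeSum_congr [DecidableEq V] [DecidableEq W] (φ : ℕ → ℚ)
    {G : SimpleGraph V} {H : SimpleGraph W} (e : G ≃g H) :
    codegreeSum φ G = codegreeSum φ H := by
  classical
  unfold codegreeSum
  refine Fintype.sum_equiv e.toEquiv _ _ fun a => Fintype.sum_equiv e.toEquiv _ _ fun b => ?_
  have : H.commonNeighbors (e a) (e b) = e '' G.commonNeighbors a b := by
    ext c
    obtain ⟨c, rfl⟩ := e.surjective c
    rw [e.injective.mem_set_image]
    simp [SimpleGraph.mem_commonNeighbors, e.map_adj_iff]
  change (if a = b then (0 : ℚ) else _) = if e a = e b then 0 else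
    φ (H.commonNeighbors (e a) (e b)).ncard
  simp only [e.injective.eq_iff, this, Set.ncard_image_of_injective _ e.injective]

/-- A pair with `c` common neighbours lies in `n - 2` cards. In the `c` cards that delete one of the
common neighbours its codegree is `c - 1`, in the others it is `c`. For `c = 0` the truncated
`c - 1` is harmless, being multiplied by `c`. -/
theorem sum_codegreeSum_card [DecidableEq V] (φ : ℕ → ℚ) (G : SimpleGraph V) :
    ∑ v, codegreeSum φ (card G v) = codegreeSum
      (fun c => (Fintype.card V - 2 - c) * φ c + c * φ (c - 1)) G := by
  classical
  have h (v : V) : codegreeSum φ (card G v) = ∑ a, ∑ b, if a = b then 0 else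
      if v = a ∨ v = b then 0 else φ (G.commonNeighbors a b \ {v}).ncard := by
    unfold codegreeSum
    have (a : ({v}ᶜ : Set V)) : (∑ b, if a = b then 0 else
        φ ((card G v).commonNeighbors a b).ncard) = ∑ b, if b = v then 0 else
          if (a : V) = b then 0 else φ (G.commonNeighbors a b \ {v}).ncard := by
      rw [← sum_compl_singleton]
      simp only [ncard_commonNeighbors_card, Subtype.ext_iff]
    simp only [this]
    rw [sum_compl_singleton v fun a => ∑ b, if b = v then (0 : ℚ) else
          if (a : V) = b then 0 else φ (G.commonNeighbors a b \ {v}).ncard]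
    refine Finset.sum_congr rfl fun a _ => ?_
    split_ifs with ha
    · symm
      exact Finset.sum_eq_zero fun b _ => by simp [ha]
    · refine Finset.sum_congr rfl fun b _ => ?_
      have : ¬ v = a := fun h => ha h.symm
      simp only [this, false_or, eq_comm (a := v)]
      split_ifs <;> rfl
  simp only [h]
  rw [Finset.sum_comm]
  refine Finset.sum_congr rfl fun a _ => ?_
  rw [Finset.sum_comm]
  refine Finset.sum_congr rfl fun b _ => ?_
  split_ifs with hab
  · simp
  set N := G.commonNeighbors a b
  have ha : a ∉ N := fun h => G.irrefl h.1
  have hb : b ∉ N := fun h => G.irrefl h.2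
  have hterm (v : V) : (if v = a ∨ v = b then 0 else φ (N \ {v}).ncard) =
      φ N.ncard - (if v = a then φ N.ncard else 0) - (if v = b then φ N.ncard else 0) +
        if v ∈ N then φ (N.ncard - 1) - φ N.ncard else 0 := by
    by_cases hva : v = a
    · subst hva; simp [ha, hab]
    by_cases hvb : v = b
    · subst hvb; simp [hb, hva]
    by_cases hv : v ∈ N
    · simp [hva, hvb, hv, Set.ncard_sdiff_singleton_of_mem hv]
    · simp [hva, hvb, hv]
  simp only [hterm, Finset.sum_add_distrib, Finset.sum_sub_distrib]
  have hsum (q : ℚ) : ∑ v, (if v ∈ N then q else 0) = N.ncard * q := by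
    rw [← Finset.sum_filter, Finset.sum_const, nsmul_eq_mul, ← Set.ncard_coe_finset]
    simp
  rw [hsum]
  simp
  ring

/-- The recursion `(m + 1 - c) φ(c) + c φ(c - 1) = [c = 0]` can be solved up to `c = m`. -/
theorem exists_codegree_weight (m : ℕ) : ∃ φ : ℕ → ℚ, ∀ c ≤ m,
    ((m : ℚ) + 1 - c) * φ c + c * φ (c - 1) = if c = 0 then 1 else 0 := by
  refine ⟨fun c => Nat.rec (1 / ((m : ℚ) + 1)) (fun k r => -((k + 1) * r) / (m - k)) c,
    fun c hc => ?_⟩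
  cases c with
  | zero =>
    have : (m : ℚ) + 1 ≠ 0 := by positivity
    simp [this]
  | succ k =>
    have : (m : ℚ) - k ≠ 0 := by
      rw [sub_ne_zero]; exact_mod_cast (by omega : m ≠ k)
    simp only [Nat.add_sub_cancel, if_neg (Nat.succ_ne_zero k)]
    push_cast
    field_simp
    ring

/-- The codegrees avoid the value `n - 2`, the one at which the recursion for the weights breaks
down. -/
theorem codegree_le (G : SimpleGraph V) (tG : G.CliqueFree 3) (mG : MinDegreeThree G) {m : ℕ}
    (hV : Fintype.card V = m + 3) {a b : V} (hab : a ≠ b) :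
    (G.commonNeighbors a b).ncard ≤ m := by
  classical
  have tri {a b c : V} (h₁ : G.Adj a b) (h₂ : G.Adj b c) : ¬ G.Adj a c :=
    not_adj_of_cliqueFree_three tG h₁ h₂
  -- A neighbour `d` of a neighbour of `a` is not a neighbour of `a`.
  obtain ⟨c, hac, -, -⟩ := mG a a b
  obtain ⟨d, hcd, hda, hdb⟩ := mG c a b
  have hd : d ∉ G.commonNeighbors a b := fun h => tri hac hcd h.1
  have hsub : G.commonNeighbors a b ⊆ (({a, b, d} : Finset V)ᶜ : Finset V) := by
    intro v hv
    simp only [Finset.coe_compl, Set.mem_compl_iff, Finset.mem_coe, Finset.mem_insert,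
      Finset.mem_singleton, not_or]
    refine ⟨?_, ?_, ?_⟩ <;> rintro rfl
    exacts [G.irrefl hv.1, G.irrefl hv.2, hd hv]
  refine (Set.ncard_le_ncard hsub).trans ?_
  rw [Set.ncard_coe_finset, Finset.card_compl, hV, Finset.card_eq_three.2
    ⟨a, b, d, hab, hda.symm, hdb.symm, rfl⟩]
  omega

/-- The cards determine the number of ordered pairs of codegree zero: summing the weights `φ` over
all cards counts each such pair once and every other pair with total weight zero. -/
theorem codegreeSum_zero_eq_of_cards [DecidableEq V] [DecidableEq W]
    {G : SimpleGraph V} {H : SimpleGraph W} (tG : G.CliqueFree 3)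
    (tH : H.CliqueFree 3) (mG : MinDegreeThree G) (mH : MinDegreeThree H) (σ : V ≃ W)
    (hσ : ∀ v, Nonempty (card G v ≃g card H (σ v))) (hV : 2 < Fintype.card V) :
    codegreeSum (fun c => if c = 0 then 1 else 0) G =
      codegreeSum (fun c => if c = 0 then 1 else 0) H := by
  classical
  obtain ⟨m, hm⟩ := Nat.exists_eq_add_of_lt hV
  have hm : Fintype.card V = m + 3 := by omega
  obtain ⟨φ, hφ⟩ := exists_codegree_weight m
  have aux {U : Type u} [Fintype U] [DecidableEq U] (K : SimpleGraph U) (tK : K.CliqueFree 3)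
      (mK : MinDegreeThree K) (hU : Fintype.card U = m + 3) :
      ∑ u, codegreeSum φ (card K u) = codegreeSum (fun c => if c = 0 then 1 else 0) K := by
    rw [sum_codegreeSum_card]
    unfold codegreeSum
    refine Finset.sum_congr rfl fun a _ => Finset.sum_congr rfl fun b _ => ?_
    beta_reduce
    split_ifs with hab h0
    · rfl
    · have := hφ _ (codegree_le K tK mK hU hab)
      rw [if_pos h0] at this
      rw [← this, hU]; push_cast; ring
    · have := hφ _ (codegree_le K tK mK hU hab)
      rw [if_neg h0] at this
      rw [← this, hU]; push_cast; ring
  rw [← aux G tG mG hm, ← aux H tH mH (Fintype.card_congr σ ▸ hm), ← Equiv.sum_comp σ]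
  exact Finset.sum_congr rfl fun v _ => codegreeSum_congr φ (hσ v).some

theorem sum_adj_eq_twice_edges (G : SimpleGraph V) [DecidableEq V] [DecidableRel G.Adj] :
    ∑ a, ∑ b, (if G.Adj a b then (1 : ℚ) else 0) = 2 * G.edgeFinset.card := by
  have h := G.sum_degrees_eq_twice_card_edges
  have h' : ∑ a, (G.degree a : ℚ) = 2 * G.edgeFinset.card := by exact_mod_cast h
  rw [← h']
  refine Finset.sum_congr rfl fun a _ => ?_
  rw [Finset.sum_boole, ← SimpleGraph.card_neighborFinset_eq_degree]
  congr 2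
  ext; simp

theorem codegree_eq_zero_of_adj {G : SimpleGraph V} (tG : G.CliqueFree 3) {a b : V}
    (h : G.Adj a b) : (G.commonNeighbors a b).ncard = 0 := by
  rw [Set.ncard_eq_zero, Set.eq_empty_iff_forall_notMem]
  exact fun c hc => not_adj_of_cliqueFree_three tG hc.1.symm h hc.2.symm

/-- The diameter is recognizable: in a triangle-free graph adjacent vertices have codegree zero,
so every nonadjacent pair has a common neighbour exactly when the number of ordered pairs of
codegree zero is twice the number of edges. -/
theorem hasCommonNeighbors_of_cards {G : SimpleGraph V} {H : SimpleGraph W} (tG : G.CliqueFree 3)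
    (tH : H.CliqueFree 3) (mG : MinDegreeThree G) (mH : MinDegreeThree H)
    (dG : HasCommonNeighbors G) (σ : V ≃ W) (hσ : ∀ v, Nonempty (card G v ≃g card H (σ v)))
    (hV : 2 < Fintype.card V) : HasCommonNeighbors H := by
  classical
  have hG : codegreeSum (fun c => if c = 0 then 1 else 0) G = 2 * G.edgeFinset.card := by
    rw [← sum_adj_eq_twice_edges]
    unfold codegreeSum
    refine Finset.sum_congr rfl fun a _ => Finset.sum_congr rfl fun b _ => ?_
    by_cases hab : a = b
    · subst hab; simp
    by_cases hadj : G.Adj a b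
    · simp [hab, hadj, codegree_eq_zero_of_adj tG hadj]
    · obtain ⟨c, hca, hcb⟩ := dG a b hab hadj
      have : (G.commonNeighbors a b).ncard ≠ 0 :=
        Set.ncard_ne_zero_of_mem (show c ∈ G.commonNeighbors a b from ⟨hca.symm, hcb.symm⟩)
      simp [hab, hadj, this]
  have hH : ∑ a, ∑ b, (if H.Adj a b then (1 : ℚ) else 0) =
      codegreeSum (fun c => if c = 0 then 1 else 0) H := by
    rw [sum_adj_eq_twice_edges, ← codegreeSum_zero_eq_of_cards tG tH mG mH σ hσ hV, hG,
      edges_eq_of_cards σ hσ hV]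
  have hle (a b : W) : (if H.Adj a b then (1 : ℚ) else 0) ≤
      if a = b then 0 else if (H.commonNeighbors a b).ncard = 0 then 1 else 0 := by
    by_cases hadj : H.Adj a b
    · simp [hadj, hadj.ne, codegree_eq_zero_of_adj tH hadj]
    · rw [if_neg hadj]; positivity
  intro a b hab hadj
  have h₁ := (Finset.sum_eq_sum_iff_of_le fun a _ => Finset.sum_le_sum fun b _ => hle a b).1 hH
    a (Finset.mem_univ a)
  have h₂ := (Finset.sum_eq_sum_iff_of_le fun b _ => hle a b).1 h₁ b (Finset.mem_univ b)
  have h₃ : (H.commonNeighbors a b).ncard ≠ 0 := by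
    intro h
    simp [hab, hadj, h] at h₂
  obtain ⟨c, hc⟩ := Set.nonempty_of_ncard_ne_zero h₃
  exact ⟨c, hc.1.symm, hc.2.symm⟩

end Codegree

/-! ### Reconstruction -/

/-- An isomorphism of cards extends to a bijection of the vertices that matches the deleted
vertices. -/
theorem exists_equiv_extending_card_iso {V W : Type u} {G : SimpleGraph V} {H : SimpleGraph W}
    {x : V} {y : W} (e : card G x ≃g card H y) :
    ∃ f : V ≃ W, ∀ a b, a ≠ x → b ≠ x → (G.Adj a b ↔ H.Adj (f a) (f b)) := by
  classical
  let f : V ≃ W := (Equiv.optionSubtypeNe x).symm.trans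
    ((Equiv.optionCongr (show {a // a ≠ x} ≃ {b // b ≠ y} from e.toEquiv)).trans
      (Equiv.optionSubtypeNe y))
  have hf (a : V) (ha : a ≠ x) : f a = e ⟨a, ha⟩ := by
    simp only [f, Equiv.trans_apply, Equiv.optionSubtypeNe_symm_of_ne ha]
    rfl
  refine ⟨f, fun a b ha hb => ?_⟩
  rw [hf a ha, hf b hb]
  exact (e.map_rel_iff (a := ⟨a, ha⟩) (b := ⟨b, hb⟩)).symm

end GraphRecon

theorem theorem4 {V : Type u} [Fintype V] (G : SimpleGraph V)
    (hfree : G.CliqueFree 3) (hdiam : G.diam = 2)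
    (hconn : GraphRecon.connectivity G = 3) :
    GraphRecon.Reconstructible G := by
  classical
  intro W _ H hdeck
  have dG := GraphRecon.hasCommonNeighbors_of_diam_eq_two hdiam
  have degG (v : V) : 3 ≤ G.degree v := hconn ▸ GraphRecon.connectivity_le_degree v
  obtain ⟨v, hv⟩ := GraphRecon.exists_degree_eq_three hfree dG hconn
  have hcard := GraphRecon.four_lt_card hfree degG v
  obtain ⟨σ, hσ⟩ := GraphRecon.exists_equiv_of_deck_eq hdeck
  have degH (w : W) : 3 ≤ H.degree w := by
    obtain ⟨u, rfl⟩ := σ.surjective w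
    rw [← GraphRecon.degree_eq_of_cards σ hσ (by omega)]
    exact degG u
  have mG := GraphRecon.MinDegreeThree.of_three_le_degree degG
  have mH := GraphRecon.MinDegreeThree.of_three_le_degree degH
  have tH := GraphRecon.cliqueFree_three_of_cards σ hσ (by omega) hfree
  have dH := GraphRecon.hasCommonNeighbors_of_cards hfree tH mG mH dG σ hσ (by omega)
  obtain ⟨x, y, z, hxyz, hP⟩ := GraphRecon.exists_balanced_neighbor hv
  obtain ⟨f, hf⟩ := GraphRecon.exists_equiv_extending_card_iso (hσ x).some
  -- Pull `H` back to a graph on the vertices of `G` that agrees with `G` away from `x`.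
  have hGH : G = H.comap f := GraphRecon.eq_of_agree (x := x) hf hfree
    (tH.comap ⟨(SimpleGraph.Embedding.comap f.toEmbedding H).toCopy⟩) dG
    (fun a b hab hadj => by
      obtain ⟨c, hca, hcb⟩ := dH (f a) (f b) (f.injective.ne hab) hadj
      exact ⟨f.symm c, by simpa using hca, by simpa using hcb⟩)
    (fun a p q => by
      obtain ⟨r, har, hrp, hrq⟩ := mH (f a) (f p) (f q)
      refine ⟨f.symm r, by simpa using har, ?_, ?_⟩ <;> rintro rfl <;> simp at hrp hrq)
    hxyz hP
  rw [hGH]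
  exact ⟨SimpleGraph.Iso.comap f H⟩
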